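/- All graphs are undirected, simple and connected; $d$ is the graph distance and $(x|y)_w=\frac12\big(d(x,w)+d(y,w)-d(x,y)\big)$. The hyperbolicity $\delta(G)$ is the least $\delta\ge 0$ such that $(x|y)_w\ge\min\{(x|z)_w,(y|z)_w\}-\delta$ for all vertices $w,x,y,z$ of $G$. A BFS-tree of $G$ rooted at $w$ is a spanning tree $T$ of $G$ with $d_T(w,v)=d(w,v)$ for every vertex $v$. For such $w,T$ the rooted insize is $\rho_{w,T}(G)=\max_{x,y} d(x_y,y_x)$, where $x_y$ and $y_x$ are the vertices at distance $\lfloor (x|y)_w\rfloor$ from $w$ on the paths of $T$ from $w$ to $x$ and from $w$ to $y$, respectively. Let $\rho_-(G)$ (the minsize) and $\rho_+(G)$ be the minimum and the maximum of $\rho_{w,T}(G)$ over all vertices $w$ and all BFS-trees $T$ rooted at $w$. (1) There is a constant $C$ such that for every integer $k\ge 1$ there is a finite graph $H^*_k$ with $|\delta(H^*_k)-k|\le C$ and $\rho_{w,T}(H^*_k)\ge 4k-2$ for every vertex $w$ and every BFS-tree $T$ rooted at $w$; that is, $\rho_+(H^*_k)\ge\rho_-(H^*_k)\ge 4k-2$.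 (2) For every integer $k\ge 1$ there is a finite graph $G^*_k$ with $\delta(G^*_k)=4k$ and $\rho_-(G^*_k)\le 2k$. (3) Consequently, optimizing the basepoint and the tree does not improve the approximation factor $8$: if $f:\mathbb N\to\mathbb R$ is nondecreasing and $a,b\in\mathbb R$ are such that $\delta(G)\le f(\rho_-(G))\le a\,\delta(G)+b$ for every finite graph $G$, then $a\ge 8$. -/

import Mathlib

namespace RootedInsize

/-- The Gromov product `(x|y)_w` in the graph metric of `G`. -/
noncomputable def gromovProduct {V : Type*} (G : SimpleGraph V) (w x y : V) : ℝ :=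
  ((G.dist x w : ℝ) + (G.dist y w : ℝ) - (G.dist x y : ℝ)) / 2

/-- `G` (with its graph metric on the vertex set) is `δ`-hyperbolic. -/
def IsHyperbolic {V : Type*} (G : SimpleGraph V) (δ : ℝ) : Prop :=
  ∀ w x y z : V,
    min (gromovProduct G w x z) (gromovProduct G w y z) - δ ≤ gromovProduct G w x y

/-- The hyperbolicity `δ(G)`: the least `δ ≥ 0` such that `G` is `δ`-hyperbolic
(for a finite graph it is attained, see `isLeast_hyperbolicity`). -/
noncomputable def hyperbolicity {V : Type*} (G : SimpleGraph V) : ℝ :=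
  sInf {δ : ℝ | 0 ≤ δ ∧ IsHyperbolic G δ}

theorem isLeast_hyperbolicity {V : Type*} [Finite V] (G : SimpleGraph V) :
    IsLeast {δ : ℝ | 0 ≤ δ ∧ IsHyperbolic G δ} (hyperbolicity G) := by
  have hbdd : BddBelow {δ : ℝ | 0 ≤ δ ∧ IsHyperbolic G δ} := ⟨0, fun δ h => h.1⟩
  have hcl : IsClosed {δ : ℝ | 0 ≤ δ ∧ IsHyperbolic G δ} := by
    simp only [IsHyperbolic, Set.ofPred_and, Set.ofPred_forall]
    refine isClosed_Ici.inter ?_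
    refine isClosed_iInter fun w => isClosed_iInter fun x => isClosed_iInter fun y =>
      isClosed_iInter fun z => ?_
    exact isClosed_le (by fun_prop) continuous_const
  have hne : {δ : ℝ | 0 ≤ δ ∧ IsHyperbolic G δ}.Nonempty := by
    obtain ⟨M, hM⟩ := (Set.finite_range (fun p : V × V × V × V =>
      min (gromovProduct G p.1 p.2.1 p.2.2.2) (gromovProduct G p.1 p.2.2.1 p.2.2.2)
        - gromovProduct G p.1 p.2.1 p.2.2.1)).bddAbove
    refine ⟨max M 0, le_max_right _ _, fun w x y z => ?_⟩
    have h1 := hM (Set.mem_range_self (w, x, y, z))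
    have h2 := le_max_left M 0
    simp only at h1
    linarith
  exact ⟨hcl.csInf_mem hne hbdd, fun δ h => csInf_le hbdd h⟩

/-- `T` is a BFS-tree of `G` rooted at `w`: a spanning tree of `G` in which every vertex has
the same distance to `w` as in `G`. -/
def IsBFSTree {V : Type*} (G : SimpleGraph V) (w : V) (T : SimpleGraph V) : Prop :=
  T ≤ G ∧ T.IsTree ∧ ∀ v : V, T.dist w v = G.dist w v

/-- `u` is the vertex at distance `r` from `w` on the path `[w,x]_T` of the tree `T`. -/
def IsTreePathVertexAt {V : Type*} (T : SimpleGraph V) (w x : V) (r : ℕ) (u : V) : Prop :=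
  ∃ p : T.Walk w x, p.IsPath ∧ u ∈ p.support ∧ T.dist w u = r

/-- The rooted insize `ρ_{w,T}(G)`: the supremum of `d(x_y, y_x)` over all vertices `x, y`,
where `x_y` and `y_x` are the vertices of `[w,x]_T` and `[w,y]_T` at distance `⌊(x|y)_w⌋`
from `w`. -/
noncomputable def rootedInsize {V : Type*} (G : SimpleGraph V) (w : V) (T : SimpleGraph V) :
    ℕ∞ :=
  sSup {n : ℕ∞ | ∃ x y xy yx : V,
    IsTreePathVertexAt T w x ⌊gromovProduct G w x y⌋₊ xy ∧
    IsTreePathVertexAt T w y ⌊gromovProduct G w x y⌋₊ yx ∧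
    n = (G.dist xy yx : ℕ∞)}

/-- The minsize `ρ₋(G)`: the minimum of `ρ_{w,T}(G)` over all basepoints and BFS-trees. -/
noncomputable def minsize {V : Type*} (G : SimpleGraph V) : ℕ∞ :=
  sInf {n : ℕ∞ | ∃ (w : V) (T : SimpleGraph V), IsBFSTree G w T ∧ n = rootedInsize G w T}

/-- The maxsize `ρ₊(G)`: the maximum of `ρ_{w,T}(G)` over all basepoints and BFS-trees. -/
noncomputable def maxsize {V : Type*} (G : SimpleGraph V) : ℕ∞ :=
  sSup {n : ℕ∞ | ∃ (w : V) (T : SimpleGraph V), IsBFSTree G w T ∧ n = rootedInsize G w T}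

end RootedInsize

/-! Both families are nearly planar: integer coordinates reproduce the graph metric up to a bounded
error. In the ℓ¹ plane each coordinate obeys the four-point inequality of a line, so a large defect
forces four points into the corners cut out by two wide crossing strips
(`hyperbolicity_le_of_planar`). Hyperbolicity then measures the largest square spanned by the
region.

Small minsize: in a square grid of side `2 * n`, rooted at the centre, the tree routes first
equalize the two absolute coordinates and then descend along the diagonal. Two routes cut at their
Gromov product stay within `n` of each other for even `n` (`routes_close`), while the hyperbolicity
is `2 * n`.

Large minsize: an L-shape holds only squares of side about `k`, although its two outer boundary arms
separate much further. A second layer, consisting of these arms alone and carrying the only exit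
from the L, forces shortest routes from the exit to the arm ends to follow the boundary, since a
visit to the full layer costs two extra steps. Two L-shapes are glued at the exit, so that for every
basepoint the L on the other side is entered through it (`le_dist_across`, `boundary_point_eq`).

The factor 8 comes from comparing a grid of hyperbolicity `8 * k - 4` and minsize at most `4 * k -
2` with an L-shape graph of hyperbolicity `k + O(1)` and minsize at least `4 * k - 2`. -/

namespace RootedInsize

open SimpleGraph

/-! ### Distance bounds from Lipschitz functions and descending walks -/

section General

variable {V : Type*} {G : SimpleGraph V}

/-- A function that increases by at most one along edges is `1`-Lipschitz. -/
theorem le_add_dist (hG : G.Connected) (f : V → ℤ)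
    (hf : ∀ a b, G.Adj a b → f b ≤ f a + 1) (a b : V) : f b ≤ f a + G.dist a b := by
  obtain ⟨p, hp⟩ := hG.exists_walk_length_eq_dist a b
  rw [← hp]
  clear hp
  induction p with
  | nil => simp
  | cons h p ih =>
    have := hf _ _ h
    simp only [Walk.length_cons]
    push_cast
    omega

/-- A function decreasing along suitable edges bounds the length of a walk to the target. -/
theorem exists_walk_of_descent (P : V → Prop) (f : V → ℕ) (b : V)
    (h : ∀ v, P v → v ≠ b → ∃ v', P v' ∧ G.Adj v v' ∧ f v' < f v) (v : V) (hv : P v) :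
    ∃ p : G.Walk v b, p.length ≤ f v := by
  induction hn : f v using Nat.strong_induction_on generalizing v with
  | _ n ih =>
    by_cases hvb : v = b
    · subst hvb
      exact ⟨Walk.nil, by simp⟩
    · obtain ⟨v', hv', hadj, hlt⟩ := h v hv hvb
      obtain ⟨p, hp⟩ := ih (f v') (hn ▸ hlt) v' hv' rfl
      exact ⟨Walk.cons hadj p, by simp only [Walk.length_cons]; omega⟩

theorem exists_adj_dist_succ (hG : G.Connected) (w v : V) (hv : v ≠ w) :
    ∃ u, G.Adj v u ∧ G.dist w u + 1 = G.dist w v := by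
  obtain ⟨p, hp⟩ := hG.exists_walk_length_eq_dist v w
  cases p with
  | nil => exact absurd rfl hv
  | @cons _ u _ h p =>
    refine ⟨u, h, ?_⟩
    have h1 := dist_le p
    have h2 := hG.dist_triangle (u := w) (v := u) (w := v)
    have h3 := dist_eq_one_iff_adj.2 h
    rw [dist_comm (u := u) (v := v)] at h2
    rw [dist_comm (u := w) (v := v)] at h2 ⊢
    rw [dist_comm (u := w) (v := u)] at h2 ⊢
    simp only [Walk.length_cons] at hp
    omega

/-! ### BFS-trees and parent maps -/

/-- The graph joining every vertex with its parent. -/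
def parentGraph (par : V → V) : SimpleGraph V := SimpleGraph.fromRel fun a b => par a = b

theorem parentGraph_adj {par : V → V} {a b : V} :
    (parentGraph par).Adj a b ↔ a ≠ b ∧ (par a = b ∨ par b = a) := by
  simp [parentGraph]

/-- `par` sends each vertex other than `w` to a neighbour closer to `w`. -/
structure IsParentMap (G : SimpleGraph V) (w : V) (par : V → V) : Prop where
  root : par w = w
  adj : ∀ v, v ≠ w → G.Adj v (par v)
  dist : ∀ v, v ≠ w → G.dist w (par v) + 1 = G.dist w v

variable {w : V} {par : V → V}

theorem IsParentMap.le (h : IsParentMap G w par) : parentGraph par ≤ G := by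
  have key : ∀ a b : V, a ≠ b → par a = b → G.Adj a b := by
    rintro a b hab rfl
    refine h.adj a fun haw => hab ?_
    rw [haw, h.root]
  intro a b hab
  obtain ⟨hne, hab | hab⟩ := parentGraph_adj.1 hab
  · exact key a b hne hab
  · exact (key b a hne.symm hab).symm

theorem IsParentMap.exists_walk (h : IsParentMap G w par) (v : V) :
    ∃ p : (parentGraph par).Walk v w, p.length ≤ G.dist w v := by
  refine exists_walk_of_descent (fun _ => True) (G.dist w) w ?_ v trivial
  intro v _ hv
  refine ⟨par v, trivial, parentGraph_adj.2 ⟨(h.adj v hv).ne, Or.inl rfl⟩, ?_⟩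
  have := h.dist v hv
  omega

theorem IsParentMap.connected (h : IsParentMap G w par) : (parentGraph par).Connected := by
  have hr : ∀ v, (parentGraph par).Reachable v w := fun v => ⟨(h.exists_walk v).choose⟩
  have : Nonempty V := ⟨w⟩
  exact ⟨fun a b => (hr a).trans (hr b).symm⟩

/-- Every edge joins some `v ≠ w` to `par v`, so there are at most `|V| - 1` edges, and a connected
graph with so few edges is a tree. Iterating `par` gives one distance inequality, containment in `G`
the other. -/
theorem IsParentMap.isBFSTree [Finite V] (h : IsParentMap G w par) :
    IsBFSTree G w (parentGraph par) := by
  classical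
  refine ⟨h.le, ?_, fun v => le_antisymm ?_ ?_⟩
  · refine isTree_iff_connected_and_card.2 ⟨h.connected, le_antisymm ?_
      h.connected.card_vert_le_card_edgeSet_add_one⟩
    have hsurj : Function.Surjective
        (fun v : {v : V // v ≠ w} => (⟨s(v.1, par v.1),
          parentGraph_adj.2 ⟨(h.adj v v.2).ne, Or.inl rfl⟩⟩ : (parentGraph par).edgeSet)) := by
      rintro ⟨e, he⟩
      induction e using Sym2.ind with
      | _ a b =>
        have key : ∀ a b : V, a ≠ b → par a = b → a ≠ w := by
          rintro a b hab rfl haw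
          exact hab (by rw [haw, h.root])
        obtain ⟨hne, hab | hab⟩ := parentGraph_adj.1 he
        · exact ⟨⟨a, key a b hne hab⟩, by simp [hab]⟩
        · exact ⟨⟨b, key b a hne.symm hab⟩, by simp [hab, Sym2.eq_swap]⟩
    have h1 := Nat.card_le_card_of_surjective _ hsurj
    have h2 : Nat.card {v : V // v ≠ w} + 1 = Nat.card V := by
      have := Fintype.ofFinite V
      have hpos : 0 < Fintype.card V := Fintype.card_pos_iff.2 ⟨w⟩
      simp only [Nat.card_eq_fintype_card, ne_eq, Fintype.card_subtype_compl,
        Fintype.card_unique]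
      omega
    rw [← h2]
    exact Nat.succ_le_succ h1
  · obtain ⟨p, hp⟩ := h.exists_walk v
    rw [SimpleGraph.dist_comm]
    exact (dist_le p).trans hp
  · exact (h.connected w v).dist_anti h.le

theorem exists_isBFSTree [Finite V] (hG : G.Connected) (w : V) :
    ∃ T, IsBFSTree G w T := by
  have hex : ∀ v, ∃ u, (v = w → u = w) ∧ (v ≠ w → G.Adj v u ∧ G.dist w u + 1 = G.dist w v) := by
    intro v
    by_cases hv : v = w
    · exact ⟨w, fun _ => rfl, fun h => absurd hv h⟩
    · obtain ⟨u, hu⟩ := exists_adj_dist_succ hG w v hv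
      exact ⟨u, fun h => absurd h hv, fun _ => hu⟩
  choose par hpar using hex
  have h : IsParentMap G w par :=
    ⟨(hpar w).1 rfl, fun v hv => ((hpar v).2 hv).1, fun v hv => ((hpar v).2 hv).2⟩
  exact ⟨_, h.isBFSTree⟩

/-- A walk to the root of length `G.dist w x` has no step to spare, and a step from a parent to a
child would move away from the root; hence every step applies `par`. -/
theorem IsParentMap.eq_iterate_of_mem_support (h : IsParentMap G w par) {x : V}
    (p : (parentGraph par).Walk x w) (hp : p.length = G.dist w x) {u : V}
    (hu : u ∈ p.support) : ∃ n, u = par^[n] x := by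
  suffices H : ∀ (y : V) (p : (parentGraph par).Walk x y), y = w → p.length = G.dist w x →
      u ∈ p.support → ∃ n, u = par^[n] x from H w p rfl hp hu
  clear hu hp p
  intro y p
  induction p with
  | nil =>
    intro _ _ hu
    exact ⟨0, by simpa using hu⟩
  | @cons x x' y hadj p ih =>
    intro hy hp hu
    subst hy
    simp only [Walk.length_cons] at hp
    have hle : G.dist y x' ≤ p.length := by
      rw [dist_comm]
      simpa using dist_le (p.mapLe h.le)
    obtain ⟨hne, hpar | hpar⟩ := parentGraph_adj.1 hadj
    · rw [Walk.support_cons, List.mem_cons] at hu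
      rcases hu with rfl | hu
      · exact ⟨0, rfl⟩
      · have hx : x ≠ y := by
          rintro rfl
          exact hne (by rw [← hpar, h.root])
        have := h.dist x hx
        rw [hpar] at this
        obtain ⟨n, hn⟩ := ih rfl (by omega) hu
        exact ⟨n + 1, by rw [hn, Function.iterate_succ_apply, hpar]⟩
    · have hx : x' ≠ y := by
        rintro rfl
        exact hne (by rw [← hpar, h.root])
      have := h.dist x' hx
      rw [hpar] at this
      omega

theorem IsParentMap.of_isTreePathVertexAt [Finite V] (h : IsParentMap G w par) {x u : V} {r : ℕ}
    (hu : IsTreePathVertexAt (parentGraph par) w x r u) :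
    (∃ n, u = par^[n] x) ∧ G.dist w u = r := by
  obtain ⟨p, hp, hmem, hr⟩ := hu
  have hT := h.isBFSTree
  refine ⟨?_, by rw [← hT.2.2, hr]⟩
  obtain ⟨q, hq, hlen⟩ := h.connected.exists_path_of_dist w x
  have hpq : p = q := congrArg Subtype.val
    ((hT.2.1.isAcyclic.subsingleton_path w x).elim ⟨p, hp⟩ ⟨q, hq⟩)
  subst hpq
  refine h.eq_iterate_of_mem_support p.reverse ?_ ?_
  · rw [Walk.length_reverse, hlen, hT.2.2]
  · rw [Walk.support_reverse]
    simpa using hmem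

/-- Tree paths from the root are geodesics of `G`; the last bound records this without reference to
`T`, which is all that the lower bound on the insize needs. -/
theorem IsBFSTree.exists_isTreePathVertexAt {T : SimpleGraph V} (hT : IsBFSTree G w T) {x : V}
    {r : ℕ} (hr : r ≤ G.dist w x) :
    ∃ u, IsTreePathVertexAt T w x r u ∧ G.dist w u = r ∧ G.dist u x + r ≤ G.dist w x := by
  have hc := hT.2.1.connected
  obtain ⟨p, hp, hlen⟩ := hc.exists_path_of_dist w x
  have hx := hT.2.2 x
  have h1 := dist_le (p.take r)
  have h2 := dist_le (p.drop r)
  have h3 := hc.dist_triangle (u := w) (v := p.getVert r) (w := x)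
  rw [Walk.take_length] at h1
  rw [Walk.drop_length] at h2
  have h4 : T.dist w (p.getVert r) = r := by omega
  refine ⟨p.getVert r, ⟨p, hp, p.getVert_mem_support r, h4⟩, by rw [← hT.2.2, h4], ?_⟩
  have h5 := (hc (p.getVert r) x).dist_anti hT.1
  omega

/-! ### Insize bounds and finiteness -/

theorem le_rootedInsize {T : SimpleGraph V} {x y a b : V} {r : ℕ}
    (hr : ⌊gromovProduct G w x y⌋₊ = r) (ha : IsTreePathVertexAt T w x r a)
    (hb : IsTreePathVertexAt T w y r b) : (G.dist a b : ℕ∞) ≤ rootedInsize G w T := by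
  subst hr
  exact le_sSup ⟨x, y, a, b, ha, hb, rfl⟩

theorem rootedInsize_ne_top [Finite V] (T : SimpleGraph V) : rootedInsize G w T ≠ ⊤ := by
  obtain ⟨N, hN⟩ := (Set.finite_range fun p : V × V => G.dist p.1 p.2).bddAbove
  refine ne_top_of_le_ne_top (ENat.natCast_ne_top N) (sSup_le ?_)
  rintro n ⟨x, y, a, b, -, -, rfl⟩
  exact_mod_cast hN ⟨(a, b), rfl⟩

theorem minsize_ne_top [Finite V] (hG : G.Connected) : minsize G ≠ ⊤ := by
  obtain ⟨w⟩ := hG.nonempty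
  obtain ⟨T, hT⟩ := exists_isBFSTree hG w
  exact ne_top_of_le_ne_top (rootedInsize_ne_top T) (sInf_le ⟨w, T, hT, rfl⟩)

theorem minsize_le_maxsize [Finite V] (hG : G.Connected) : minsize G ≤ maxsize G := by
  obtain ⟨w⟩ := hG.nonempty
  obtain ⟨T, hT⟩ := exists_isBFSTree hG w
  exact (sInf_le ⟨w, T, hT, rfl⟩ : minsize G ≤ _).trans (le_sSup ⟨w, T, hT, rfl⟩)

/-! ### The four-point condition and planar coordinates -/

theorem isHyperbolic_of_fourPoint {δ : ℝ}
    (h : ∀ w x y z, (G.dist x y : ℝ) + G.dist z w ≤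
      max ((G.dist x z : ℝ) + G.dist y w) (G.dist y z + G.dist x w) + 2 * δ) :
    IsHyperbolic G δ := by
  intro w x y z
  unfold gromovProduct
  have := h w x y z
  rcases le_max_iff.1 (sub_le_iff_le_add.2 this) with h' | h'
  · have := min_le_right (((G.dist x w : ℝ) + G.dist z w - G.dist x z) / 2)
      (((G.dist y w : ℝ) + G.dist z w - G.dist y z) / 2)
    have := min_le_left (((G.dist x w : ℝ) + G.dist z w - G.dist x z) / 2)
      (((G.dist y w : ℝ) + G.dist z w - G.dist y z) / 2)
    linarith
  · have := min_le_right (((G.dist x w : ℝ) + G.dist z w - G.dist x z) / 2)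
      (((G.dist y w : ℝ) + G.dist z w - G.dist y z) / 2)
    linarith

theorem fourPoint_le_hyperbolicity [Finite V] (w x y z : V) :
    (G.dist x y : ℝ) + G.dist z w ≤
      max ((G.dist x z : ℝ) + G.dist y w) (G.dist y z + G.dist x w) + 2 * hyperbolicity G := by
  have := (isLeast_hyperbolicity G).1.2 w x y z
  unfold gromovProduct at this
  rcases min_le_iff.1 (sub_le_iff_le_add.1 this) with h | h
  · have := le_max_left ((G.dist x z : ℝ) + G.dist y w) (G.dist y z + G.dist x w)
    linarith
  · have := le_max_right ((G.dist x z : ℝ) + G.dist y w) (G.dist y z + G.dist x w)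
    linarith

/-- Four points on a line: no pairing sum exceeds both of the others. -/
theorem line_fourPoint (a b c d : ℤ) :
    (a - b).natAbs + (c - d).natAbs ≤ (a - c).natAbs + (b - d).natAbs ∨
      (a - b).natAbs + (c - d).natAbs ≤ (b - c).natAbs + (a - d).natAbs := by
  omega

/-- On a line, the surplus of one pairing sum over another is at most twice the gap separating `{a,
c}` from `{b, d}`. -/
theorem line_gap {a b c d : ℤ} {K : ℕ}
    (h : (a - c).natAbs + (b - d).natAbs + 2 * K < (a - b).natAbs + (c - d).natAbs) :
    (a + K < b ∧ a + K < d ∧ c + K < b ∧ c + K < d) ∨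
      (b + K < a ∧ b + K < c ∧ d + K < a ∧ d + K < c) := by
  omega

/-- By `line_fourPoint` neither coordinate can beat both rival pairings, so one coordinate supplies
the surplus over the first rival and the other coordinate that over the second. -/
theorem planar_gap {x₁ x₂ y₁ y₂ z₁ z₂ w₁ w₂ : ℤ} {K : ℕ}
    (h₁ : (x₁ - z₁).natAbs + (x₂ - z₂).natAbs + ((y₁ - w₁).natAbs + (y₂ - w₂).natAbs) + 2 * K <
      (x₁ - y₁).natAbs + (x₂ - y₂).natAbs + ((z₁ - w₁).natAbs + (z₂ - w₂).natAbs))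
    (h₂ : (y₁ - z₁).natAbs + (y₂ - z₂).natAbs + ((x₁ - w₁).natAbs + (x₂ - w₂).natAbs) + 2 * K <
      (x₁ - y₁).natAbs + (x₂ - y₂).natAbs + ((z₁ - w₁).natAbs + (z₂ - w₂).natAbs)) :
    ((x₁ - z₁).natAbs + (y₁ - w₁).natAbs + 2 * K < (x₁ - y₁).natAbs + (z₁ - w₁).natAbs ∧
      (y₂ - z₂).natAbs + (x₂ - w₂).natAbs + 2 * K < (x₂ - y₂).natAbs + (z₂ - w₂).natAbs) ∨
    ((x₂ - z₂).natAbs + (y₂ - w₂).natAbs + 2 * K < (x₂ - y₂).natAbs + (z₂ - w₂).natAbs ∧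
      (y₁ - z₁).natAbs + (x₁ - w₁).natAbs + 2 * K < (x₁ - y₁).natAbs + (z₁ - w₁).natAbs) := by
  have hX := line_fourPoint x₁ y₁ z₁ w₁
  have hY := line_fourPoint x₂ y₂ z₂ w₂
  generalize (x₁ - z₁).natAbs = a₁ at *
  generalize (y₁ - w₁).natAbs = a₂ at *
  generalize (x₁ - y₁).natAbs = a₃ at *
  generalize (z₁ - w₁).natAbs = a₄ at *
  generalize (y₁ - z₁).natAbs = a₅ at *
  generalize (x₁ - w₁).natAbs = a₆ at *
  generalize (x₂ - z₂).natAbs = b₁ at *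
  generalize (y₂ - w₂).natAbs = b₂ at *
  generalize (x₂ - y₂).natAbs = b₃ at *
  generalize (z₂ - w₂).natAbs = b₄ at *
  generalize (y₂ - z₂).natAbs = b₅ at *
  generalize (x₂ - w₂).natAbs = b₆ at *
  omega

/-- If planar coordinates distort the graph distance by at most `c` and no four vertices lie in the
four corners left by two crossing strips of width greater than `K`, the hyperbolicity is at most
`K + c`. -/
theorem hyperbolicity_le_of_planar (X Y : V → ℤ) (K c : ℕ)
    (hlow : ∀ u v, (X u - X v).natAbs + (Y u - Y v).natAbs ≤ G.dist u v)
    (hupp : ∀ u v, G.dist u v ≤ (X u - X v).natAbs + (Y u - Y v).natAbs + c)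
    (hsq : ∀ p q r s : V,
      (X p + K < X q ∧ X p + K < X s ∧ X r + K < X q ∧ X r + K < X s) →
      (Y p + K < Y r ∧ Y p + K < Y s ∧ Y q + K < Y r ∧ Y q + K < Y s) → False) :
    hyperbolicity G ≤ K + c := by
  refine csInf_le ⟨0, fun δ h => h.1⟩ ⟨by positivity, isHyperbolic_of_fourPoint ?_⟩
  intro w x y z
  have hN : G.dist x y + G.dist z w ≤
      max (G.dist x z + G.dist y w) (G.dist y z + G.dist x w) + 2 * (K + c) := by
    by_contra! hcon
    have h1 := le_max_left (G.dist x z + G.dist y w) (G.dist y z + G.dist x w)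
    have h2 := le_max_right (G.dist x z + G.dist y w) (G.dist y z + G.dist x w)
    have u1 := hupp x y
    have u2 := hupp z w
    have hz : (X x - X z).natAbs + (Y x - Y z).natAbs +
        ((X y - X w).natAbs + (Y y - Y w).natAbs) + 2 * K <
        (X x - X y).natAbs + (Y x - Y y).natAbs +
        ((X z - X w).natAbs + (Y z - Y w).natAbs) := by
      linarith [hlow x z, hlow y w]
    have hw : (X y - X z).natAbs + (Y y - Y z).natAbs +
        ((X x - X w).natAbs + (Y x - Y w).natAbs) + 2 * K <
        (X x - X y).natAbs + (Y x - Y y).natAbs +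
        ((X z - X w).natAbs + (Y z - Y w).natAbs) := by
      linarith [hlow y z, hlow x w]
    rcases planar_gap hz hw with ⟨hX, hY⟩ | ⟨hY, hX⟩
    -- `line_gap` pairs the first entries of the two differences on the right, so one difference is
    -- reversed. The cases below are the labellings of the four corners.
    · rw [← Int.natAbs_neg (Y x - Y y), neg_sub] at hY
      rcases line_gap hX with hX | hX <;> rcases line_gap hY with hY | hY
      · exact hsq z y x w (by tauto) (by tauto)
      · exact hsq x w z y (by tauto) (by tauto)
      · exact hsq y z w x (by tauto) (by tauto)
      · exact hsq w x y z (by tauto) (by tauto)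
    · rw [← Int.natAbs_neg (X x - X y), neg_sub] at hX
      rcases line_gap hX with hX | hX <;> rcases line_gap hY with hY | hY
      · exact hsq z x y w (by tauto) (by tauto)
      · exact hsq y w z x (by tauto) (by tauto)
      · exact hsq x z w y (by tauto) (by tauto)
      · exact hsq w y x z (by tauto) (by tauto)
  exact_mod_cast hN

end General

/-! ### The square grid -/

/-- The vertices of the square grid with coordinates between `-n` and `n`. -/
abbrev BoxVertex (n : ℕ) : Type := {p : ℤ × ℤ // p.1.natAbs ≤ n ∧ p.2.natAbs ≤ n}

/-- The square grid with coordinates between `-n` and `n`. -/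
def boxGrid (n : ℕ) : SimpleGraph (BoxVertex n) where
  Adj a b := (a.1.1 - b.1.1).natAbs + (a.1.2 - b.1.2).natAbs = 1
  symm := ⟨fun a b h => by omega⟩
  loopless := ⟨fun a h => by omega⟩

instance (n : ℕ) : Finite (BoxVertex n) := by
  refine Set.Finite.to_subtype (((Set.finite_Icc (-n : ℤ) n).prod
    (Set.finite_Icc (-n : ℤ) n)).subset ?_)
  rintro ⟨x, y⟩ ⟨hx, hy⟩
  simp only [Set.mem_prod, Set.mem_Icc] at *
  omega

theorem boxGrid_exists_walk {n : ℕ} (a b : BoxVertex n) :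
    ∃ p : (boxGrid n).Walk a b, p.length ≤ (a.1.1 - b.1.1).natAbs + (a.1.2 - b.1.2).natAbs := by
  refine exists_walk_of_descent (fun _ => True)
    (fun a => (a.1.1 - b.1.1).natAbs + (a.1.2 - b.1.2).natAbs) b ?_ a trivial
  rintro ⟨⟨x, y⟩, hx, hy⟩ - hne
  obtain ⟨⟨x', y'⟩, hx', hy'⟩ := b
  simp only [ne_eq, Subtype.mk.injEq, Prod.mk.injEq] at *
  have hstep : ∀ p q : ℤ, p.natAbs ≤ n → q.natAbs ≤ n →
      (x - p).natAbs + (y - q).natAbs = 1 →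
      (p - x').natAbs + (q - y').natAbs < (x - x').natAbs + (y - y').natAbs →
      ∃ v' : BoxVertex n, True ∧ (boxGrid n).Adj ⟨(x, y), hx, hy⟩ v' ∧
        (v'.1.1 - x').natAbs + (v'.1.2 - y').natAbs < (x - x').natAbs + (y - y').natAbs :=
    fun p q hp hq h1 h2 => ⟨⟨(p, q), hp, hq⟩, trivial, h1, h2⟩
  by_cases h : x = x'
  · rcases lt_or_gt_of_ne (fun h' => hne ⟨h, h'⟩ : y ≠ y') with h | h
    · exact hstep x (y + 1) (by omega) (by omega) (by omega) (by omega)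
    · exact hstep x (y - 1) (by omega) (by omega) (by omega) (by omega)
  · rcases lt_or_gt_of_ne h with h | h
    · exact hstep (x + 1) y (by omega) (by omega) (by omega) (by omega)
    · exact hstep (x - 1) y (by omega) (by omega) (by omega) (by omega)

theorem boxGrid_connected (n : ℕ) : (boxGrid n).Connected :=
  have : Nonempty (BoxVertex n) := ⟨⟨(0, 0), by simp⟩⟩
  ⟨fun a b => ⟨(boxGrid_exists_walk a b).choose⟩⟩

theorem boxGrid_dist {n : ℕ} (a b : BoxVertex n) :
    (boxGrid n).dist a b = (a.1.1 - b.1.1).natAbs + (a.1.2 - b.1.2).natAbs := by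
  refine le_antisymm ?_ ?_
  · obtain ⟨p, hp⟩ := boxGrid_exists_walk a b
    exact (dist_le p).trans hp
  · have h := le_add_dist (boxGrid_connected n)
      (fun v => (((a.1.1 - v.1.1).natAbs + (a.1.2 - v.1.2).natAbs : ℕ) : ℤ)) ?_ a b
    · simp only [sub_self, Int.natAbs_zero] at h
      omega
    · intro u v (huv : _ = 1)
      omega

/-- No strip wider than `2 * n` fits in the box; the four corners of the box attain the bound. -/
theorem boxGrid_hyperbolicity (n : ℕ) : hyperbolicity (boxGrid n) = 2 * n := by
  refine le_antisymm ?_ ?_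
  · have h := hyperbolicity_le_of_planar (G := boxGrid n) (fun v => v.1.1) (fun v => v.1.2)
      (2 * n) 0 (fun u v => (boxGrid_dist u v).ge) (fun u v => (boxGrid_dist u v).le) ?_
    · simpa using h
    · rintro ⟨⟨p, p'⟩, hp, hp'⟩ ⟨⟨q, q'⟩, hq, hq'⟩ - - ⟨hX, -⟩ -
      replace hX : p + ((2 * n : ℕ) : ℤ) < q := hX
      dsimp only at hp hq
      omega
  · have h := fourPoint_le_hyperbolicity (G := boxGrid n) ⟨(n, -n), by simp⟩ ⟨(-n, -n), by simp⟩
      ⟨(n, n), by simp⟩ ⟨(-n, n), by simp⟩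
    simp only [boxGrid_dist] at h
    have e1 : ((n : ℤ) - n).natAbs = 0 := by omega
    have e2 : ((n : ℤ) - -n).natAbs = 2 * n := by omega
    have e3 : (-(n : ℤ) - n).natAbs = 2 * n := by omega
    have e4 : (-(n : ℤ) - -n).natAbs = 0 := by omega
    simp only [e1, e2, e3, e4] at h
    push_cast at h
    simp only [zero_add, add_zero, max_self] at h
    linarith

/-! ### Diagonal routes and small minsize -/

/-- `(u₁, u₂)` lies on the route from `(x₁, x₂)` to the origin that first reduces the coordinate
of larger absolute value and then descends along the diagonal. -/
structure OnRoute (u₁ u₂ x₁ x₂ : ℤ) : Prop where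
  le_fst : u₁.natAbs ≤ x₁.natAbs
  le_snd : u₂.natAbs ≤ x₂.natAbs
  nonneg_fst : 0 < x₁ → 0 ≤ u₁
  nonpos_fst : x₁ < 0 → u₁ ≤ 0
  nonneg_snd : 0 < x₂ → 0 ≤ u₂
  nonpos_snd : x₂ < 0 → u₂ ≤ 0
  snd_eq : u₂.natAbs + 1 < u₁.natAbs → u₂.natAbs = x₂.natAbs
  fst_eq : u₁.natAbs < u₂.natAbs → u₁.natAbs = x₁.natAbs

/-- Lower-case letters are absolute coordinates at height `r`, capitals those of the endpoints, and
`m₁ + m₂` is the Gromov product. If the routes lie on opposite sides in one coordinate, both points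
are still near the diagonal, giving at most `r + 1` with `r ≤ n`. Evenness of `n` absorbs the extra
one, which comes from the tie at the diagonal. -/
theorem routes_close {n r a₁ a₂ b₁ b₂ A₁ A₂ B₁ B₂ d₁ d₂ m₁ m₂ : ℕ} (hn : Even n)
    (hA₁ : A₁ ≤ n) (hA₂ : A₂ ≤ n) (hB₁ : B₁ ≤ n) (hB₂ : B₂ ≤ n)
    (ha₁ : a₁ ≤ A₁) (ha₂ : a₂ ≤ A₂) (hb₁ : b₁ ≤ B₁) (hb₂ : b₂ ≤ B₂)
    (ha : a₂ + 1 < a₁ → a₂ = A₂) (ha' : a₁ < a₂ → a₁ = A₁)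
    (hb : b₂ + 1 < b₁ → b₂ = B₂) (hb' : b₁ < b₂ → b₁ = B₁)
    (har : a₁ + a₂ = r) (hbr : b₁ + b₂ = r) (hr : r = m₁ + m₂)
    (h₁ : (d₁ = a₁ - b₁ + (b₁ - a₁) ∧ m₁ = min A₁ B₁) ∨ (d₁ = a₁ + b₁ ∧ m₁ = 0))
    (h₂ : (d₂ = a₂ - b₂ + (b₂ - a₂) ∧ m₂ = min A₂ B₂) ∨ (d₂ = a₂ + b₂ ∧ m₂ = 0)) :
    d₁ + d₂ ≤ n := by
  obtain ⟨k, rfl⟩ := hn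
  rcases h₁ with ⟨rfl, rfl⟩ | ⟨rfl, rfl⟩ <;> rcases h₂ with ⟨rfl, rfl⟩ | ⟨rfl, rfl⟩ <;> omega

/-- The number `m` is the Gromov product over `0` in a single coordinate: the smaller absolute value
if the signs agree, else zero. -/
theorem natAbs_sub_cases {u v x y : ℤ} (hu : u.natAbs ≤ x.natAbs) (hv : v.natAbs ≤ y.natAbs)
    (hu0 : 0 < x → 0 ≤ u) (hu1 : x < 0 → u ≤ 0) (hv0 : 0 < y → 0 ≤ v) (hv1 : y < 0 → v ≤ 0) :
    ∃ m, 2 * m + (x - y).natAbs = x.natAbs + y.natAbs ∧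
      (((u - v).natAbs = u.natAbs - v.natAbs + (v.natAbs - u.natAbs) ∧
        m = min x.natAbs y.natAbs) ∨ ((u - v).natAbs = u.natAbs + v.natAbs ∧ m = 0)) := by
  rcases lt_trichotomy x 0 with hx | hx | hx <;> rcases lt_trichotomy y 0 with hy | hy | hy
  · exact ⟨min x.natAbs y.natAbs, by omega, Or.inl ⟨by omega, rfl⟩⟩
  · exact ⟨0, by omega, Or.inr ⟨by omega, rfl⟩⟩
  · exact ⟨0, by omega, Or.inr ⟨by omega, rfl⟩⟩
  · exact ⟨0, by omega, Or.inr ⟨by omega, rfl⟩⟩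
  · exact ⟨0, by omega, Or.inr ⟨by omega, rfl⟩⟩
  · exact ⟨0, by omega, Or.inr ⟨by omega, rfl⟩⟩
  · exact ⟨0, by omega, Or.inr ⟨by omega, rfl⟩⟩
  · exact ⟨0, by omega, Or.inr ⟨by omega, rfl⟩⟩
  · exact ⟨min x.natAbs y.natAbs, by omega, Or.inl ⟨by omega, rfl⟩⟩

theorem boxGrid_minsize_le {n : ℕ} (hn : Even n) : minsize (boxGrid n) ≤ n := by
  let w : BoxVertex n := ⟨(0, 0), by simp⟩
  have hex : ∀ v : BoxVertex n, ∃ u : BoxVertex n, (v = w → u = w) ∧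
      (v ≠ w → (boxGrid n).Adj v u ∧ (boxGrid n).dist w u + 1 = (boxGrid n).dist w v) ∧
      (∀ x₁ x₂ : ℤ, OnRoute v.1.1 v.1.2 x₁ x₂ → OnRoute u.1.1 u.1.2 x₁ x₂) := by
    rintro ⟨⟨x, y⟩, hx, hy⟩
    by_cases h0 : x = 0 ∧ y = 0
    · obtain ⟨rfl, rfl⟩ := h0
      exact ⟨w, fun _ => rfl, fun h => absurd rfl h, fun _ _ h => h⟩
    have hvw : (⟨(x, y), hx, hy⟩ : BoxVertex n) ≠ w := by simpa [w] using h0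
    have hstep : ∀ (p q : ℤ) (hp : p.natAbs ≤ n) (hq : q.natAbs ≤ n),
        (x - p).natAbs + (y - q).natAbs = 1 → p.natAbs + q.natAbs + 1 = x.natAbs + y.natAbs →
        (∀ x₁ x₂ : ℤ, OnRoute x y x₁ x₂ → OnRoute p q x₁ x₂) →
        ∃ u : BoxVertex n, ((⟨(x, y), hx, hy⟩ : BoxVertex n) = w → u = w) ∧
          ((⟨(x, y), hx, hy⟩ : BoxVertex n) ≠ w → (boxGrid n).Adj ⟨(x, y), hx, hy⟩ u ∧
            (boxGrid n).dist w u + 1 = (boxGrid n).dist w ⟨(x, y), hx, hy⟩) ∧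
          (∀ x₁ x₂ : ℤ, OnRoute x y x₁ x₂ → OnRoute u.1.1 u.1.2 x₁ x₂) := by
      intro p q hp hq h1 h2 h3
      refine ⟨⟨(p, q), hp, hq⟩, fun h => absurd h hvw, fun _ => ⟨h1, ?_⟩, h3⟩
      simpa [boxGrid_dist, w] using h2
    by_cases hxy : y.natAbs < x.natAbs
    · rcases lt_trichotomy x 0 with h | h | h
      · refine hstep (x + 1) y (by omega) (by omega) (by omega) (by omega) ?_
        rintro x₁ x₂ ⟨h1, h2, h3, h4, h5, h6, h7, h8⟩
        constructor <;> omega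
      · omega
      · refine hstep (x - 1) y (by omega) (by omega) (by omega) (by omega) ?_
        rintro x₁ x₂ ⟨h1, h2, h3, h4, h5, h6, h7, h8⟩
        constructor <;> omega
    -- A tie on the diagonal reduces the second coordinate; hence the slack of one in
    -- `OnRoute.snd_eq` but not in `OnRoute.fst_eq`.
    · rcases lt_trichotomy y 0 with h | h | h
      · refine hstep x (y + 1) (by omega) (by omega) (by omega) (by omega) ?_
        rintro x₁ x₂ ⟨h1, h2, h3, h4, h5, h6, h7, h8⟩
        constructor <;> omega
      · omega
      · refine hstep x (y - 1) (by omega) (by omega) (by omega) (by omega) ?_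
        rintro x₁ x₂ ⟨h1, h2, h3, h4, h5, h6, h7, h8⟩
        constructor <;> omega
  choose par hroot hadj hroute using hex
  have hpar : IsParentMap (boxGrid n) w par :=
    ⟨hroot w rfl, fun v hv => (hadj v hv).1, fun v hv => (hadj v hv).2⟩
  have hiter : ∀ (x : BoxVertex n) (i : ℕ),
      OnRoute (par^[i] x).1.1 (par^[i] x).1.2 x.1.1 x.1.2 := by
    intro x i
    induction i with
    | zero => exact ⟨le_rfl, le_rfl, le_of_lt, le_of_lt, le_of_lt, le_of_lt, fun _ => rfl,
        fun _ => rfl⟩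
    | succ i ih =>
      rw [Function.iterate_succ_apply']
      exact hroute _ _ _ ih
  refine (sInf_le ⟨w, _, hpar.isBFSTree, rfl⟩ : minsize (boxGrid n) ≤ _).trans (sSup_le ?_)
  rintro _ ⟨x, y, u, v, hu, hv, rfl⟩
  obtain ⟨⟨i, hi⟩, hru⟩ := hpar.of_isTreePathVertexAt hu
  obtain ⟨⟨j, hj⟩, hrv⟩ := hpar.of_isTreePathVertexAt hv
  have Hu := hiter x i
  have Hv := hiter y j
  rw [← hi] at Hu
  rw [← hj] at Hv
  obtain ⟨m₁, hm₁, hd₁⟩ := natAbs_sub_cases Hu.le_fst Hv.le_fst Hu.nonneg_fst Hu.nonpos_fst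
    Hv.nonneg_fst Hv.nonpos_fst
  obtain ⟨m₂, hm₂, hd₂⟩ := natAbs_sub_cases Hu.le_snd Hv.le_snd Hu.nonneg_snd Hu.nonpos_snd
    Hv.nonneg_snd Hv.nonpos_snd
  have hr : ⌊gromovProduct (boxGrid n) w x y⌋₊ = m₁ + m₂ := by
    have h1 : (2 * (m₁ + m₂) : ℝ) + (boxGrid n).dist x y =
        (boxGrid n).dist x w + (boxGrid n).dist y w := by
      have : 2 * (m₁ + m₂) + (boxGrid n).dist x y =
          (boxGrid n).dist x w + (boxGrid n).dist y w := by
        simp only [boxGrid_dist, w, sub_zero]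
        linarith
      exact_mod_cast this
    have h2 : gromovProduct (boxGrid n) w x y = ((m₁ + m₂ : ℕ) : ℝ) := by
      unfold gromovProduct
      push_cast
      linarith
    rw [h2, Nat.floor_natCast]
  simp only [boxGrid_dist, w, zero_sub, Int.natAbs_neg] at hru hrv
  have := routes_close hn x.2.1 x.2.2 y.2.1 y.2.2 Hu.le_fst Hu.le_snd Hv.le_fst Hv.le_snd
    Hu.snd_eq Hu.fst_eq Hv.snd_eq Hv.fst_eq hru hrv hr hd₁ hd₂
  rw [boxGrid_dist]
  exact_mod_cast this

/-! ### The two-layer L-shapes and their metric -/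

/-- Membership in the two-layer region: the bottom layer `t = 0` consists of two opposite L-shapes
without the origin, the top layer `t = 1` of the outer boundary paths through the origin. -/
def IsCornerPoint (k : ℕ) (p : ℤ × ℤ × ℤ) : Prop :=
  ((0 ≤ p.1 ∧ 0 ≤ p.2.1) ∨ (p.1 ≤ 0 ∧ p.2.1 ≤ 0)) ∧ p.1.natAbs ≤ 2 * k ∧ p.2.1.natAbs ≤ 2 * k ∧
    (p.1.natAbs ≤ k ∨ p.2.1.natAbs ≤ k) ∧
    ((p.2.2 = 0 ∧ (p.1 ≠ 0 ∨ p.2.1 ≠ 0)) ∨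
      (p.2.2 = 1 ∧ (p.1 = 0 ∨ p.2.1 = 0 ∨ p.1.natAbs = 2 * k ∨ p.2.1.natAbs = 2 * k)))

theorem isCornerPoint_bottom {k : ℕ} {x y : ℤ} (h0 : (0 ≤ x ∧ 0 ≤ y) ∨ (x ≤ 0 ∧ y ≤ 0))
    (hx : x.natAbs ≤ 2 * k) (hy : y.natAbs ≤ 2 * k) (hL : x.natAbs ≤ k ∨ y.natAbs ≤ k)
    (hne : x ≠ 0 ∨ y ≠ 0) : IsCornerPoint k (x, y, 0) :=
  ⟨h0, hx, hy, hL, Or.inl ⟨rfl, hne⟩⟩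

theorem isCornerPoint_top {k : ℕ} {x y : ℤ} (h0 : (0 ≤ x ∧ 0 ≤ y) ∨ (x ≤ 0 ∧ y ≤ 0))
    (hx : x.natAbs ≤ 2 * k) (hy : y.natAbs ≤ 2 * k) (hL : x.natAbs ≤ k ∨ y.natAbs ≤ k)
    (hb : x = 0 ∨ y = 0 ∨ x.natAbs = 2 * k ∨ y.natAbs = 2 * k) : IsCornerPoint k (x, y, 1) :=
  ⟨h0, hx, hy, hL, Or.inr ⟨rfl, hb⟩⟩

abbrev CornerVertex (k : ℕ) : Type := {p : ℤ × ℤ × ℤ // IsCornerPoint k p}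

/-- The subgraph of the cubic lattice induced on the two-layer region. -/
def cornerGraph (k : ℕ) : SimpleGraph (CornerVertex k) where
  Adj a b := (a.1.1 - b.1.1).natAbs + (a.1.2.1 - b.1.2.1).natAbs +
    (a.1.2.2 - b.1.2.2).natAbs = 1
  symm := ⟨fun a b h => by omega⟩
  loopless := ⟨fun a h => by omega⟩

instance (k : ℕ) : Finite (CornerVertex k) := by
  refine Set.Finite.to_subtype (((Set.finite_Icc (-(2 * k) : ℤ) (2 * k)).prod
    ((Set.finite_Icc (-(2 * k) : ℤ) (2 * k)).prod (Set.finite_Icc (0 : ℤ) 1))).subset ?_)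
  rintro ⟨x, y, t⟩ ⟨-, hx, hy, -, ht⟩
  simp only [Set.mem_prod, Set.mem_Icc] at *
  omega

/-- The vertex shared by the two L-shapes. -/
def cornerRoot (k : ℕ) : CornerVertex k := ⟨(0, 0, 1), by simp [IsCornerPoint]⟩

/-- An L-shape is ℓ¹-geodesic. Increasing a coordinate where the L permits takes precedence over
decreasing one, which steers the walk around the missing origin. -/
theorem lShape_step {k : ℕ} (hk : 1 ≤ k) {x y x' y' : ℤ} (h0 : 0 ≤ x ∧ 0 ≤ y)
    (h2 : x ≤ 2 * k ∧ y ≤ 2 * k) (hL : x ≤ k ∨ y ≤ k)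
    (h0' : 0 ≤ x' ∧ 0 ≤ y') (h2' : x' ≤ 2 * k ∧ y' ≤ 2 * k) (hL' : x' ≤ k ∨ y' ≤ k)
    (hn' : x' ≠ 0 ∨ y' ≠ 0) (hne : x ≠ x' ∨ y ≠ y') :
    ∃ p q : ℤ, (0 ≤ p ∧ 0 ≤ q) ∧ (p ≤ 2 * k ∧ q ≤ 2 * k) ∧ (p ≤ k ∨ q ≤ k) ∧
      (p ≠ 0 ∨ q ≠ 0) ∧ (x - p).natAbs + (y - q).natAbs = 1 ∧
      (p - x').natAbs + (q - y').natAbs < (x - x').natAbs + (y - y').natAbs := by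
  by_cases h1 : x < x' ∧ (x + 1 ≤ k ∨ y ≤ k)
  · exact ⟨x + 1, y, by omega, by omega, by omega, by omega, by omega, by omega⟩
  by_cases h3 : y < y' ∧ (y + 1 ≤ k ∨ x ≤ k)
  · exact ⟨x, y + 1, by omega, by omega, by omega, by omega, by omega, by omega⟩
  by_cases h4 : x' < x
  · exact ⟨x - 1, y, by omega, by omega, by omega, by omega, by omega, by omega⟩
  · exact ⟨x, y - 1, by omega, by omega, by omega, by omega, by omega, by omega⟩

theorem exists_walk_bottom {k : ℕ} (hk : 1 ≤ k) {ε : ℤ} (hε : ε = 1 ∨ ε = -1)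
    (a b : CornerVertex k) (ha : a.1.2.2 = 0 ∧ 0 ≤ ε * a.1.1 ∧ 0 ≤ ε * a.1.2.1)
    (hb : b.1.2.2 = 0 ∧ 0 ≤ ε * b.1.1 ∧ 0 ≤ ε * b.1.2.1) :
    ∃ p : (cornerGraph k).Walk a b,
      p.length ≤ (a.1.1 - b.1.1).natAbs + (a.1.2.1 - b.1.2.1).natAbs := by
  refine exists_walk_of_descent (fun v => v.1.2.2 = 0 ∧ 0 ≤ ε * v.1.1 ∧ 0 ≤ ε * v.1.2.1)
    (fun v => (v.1.1 - b.1.1).natAbs + (v.1.2.1 - b.1.2.1).natAbs) b ?_ a ha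
  rintro ⟨⟨x, y, t⟩, hv⟩ ⟨ht, hx, hy⟩ hne
  obtain ⟨ht', hx', hy'⟩ := hb
  have hne' : x ≠ b.1.1 ∨ y ≠ b.1.2.1 := by
    by_contra! h
    exact hne (Subtype.ext (Prod.ext h.1 (Prod.ext h.2 (ht.trans ht'.symm))))
  have m1 := hv.2.1
  have m2 := hv.2.2.1
  have m3 := hv.2.2.2.1
  have m4 := hv.2.2.2.2
  have m1' := b.2.2.1
  have m2' := b.2.2.2.1
  have m3' := b.2.2.2.2.1
  have m4' := b.2.2.2.2.2
  dsimp only at ht hx hy m1 m2 m3 m4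
  subst ht
  generalize b.1.1 = x' at *
  generalize b.1.2.1 = y' at *
  obtain ⟨p, q, c1, c2, c3, c4, c5, c6⟩ := lShape_step hk (x := ε * x) (y := ε * y)
    (x' := ε * x') (y' := ε * y') ⟨hx, hy⟩ (by rcases hε with rfl | rfl <;> omega)
    (by rcases hε with rfl | rfl <;> omega) ⟨hx', hy'⟩ (by rcases hε with rfl | rfl <;> omega)
    (by rcases hε with rfl | rfl <;> omega) (by rcases hε with rfl | rfl <;> omega)
    (by rcases hε with rfl | rfl <;> omega)
  refine ⟨⟨(ε * p, ε * q, 0), ?_⟩, ⟨rfl, ?_, ?_⟩, ?_, ?_⟩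
  · rcases hε with rfl | rfl <;> apply isCornerPoint_bottom <;> omega
  · rcases hε with rfl | rfl <;> dsimp only <;> omega
  · rcases hε with rfl | rfl <;> dsimp only <;> omega
  · simp only [cornerGraph]
    rcases hε with rfl | rfl <;> omega
  · rcases hε with rfl | rfl <;> dsimp only <;> omega

/-- Each top-layer arm is an axis followed by an end segment, so walking home along it never
increases an absolute coordinate. -/
theorem exists_walk_top_root {k : ℕ} (a : CornerVertex k) (ha : a.1.2.2 = 1) :
    ∃ p : (cornerGraph k).Walk a (cornerRoot k), p.length ≤ a.1.1.natAbs + a.1.2.1.natAbs := by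
  refine exists_walk_of_descent (fun v => v.1.2.2 = 1)
    (fun v => v.1.1.natAbs + v.1.2.1.natAbs) (cornerRoot k) ?_ a ha
  rintro ⟨⟨x, y, t⟩, hv⟩ ht hne
  dsimp only at ht
  subst ht
  have hne' : x ≠ 0 ∨ y ≠ 0 := by
    by_contra! h
    exact hne (by simp [h.1, h.2, cornerRoot])
  obtain ⟨m0, m1, m2, m3, m4⟩ := hv
  dsimp only at m0 m1 m2 m3 m4
  have hstep : ∀ p q : ℤ, ((0 ≤ p ∧ 0 ≤ q) ∨ (p ≤ 0 ∧ q ≤ 0)) → p.natAbs ≤ 2 * k →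
      q.natAbs ≤ 2 * k → (p.natAbs ≤ k ∨ q.natAbs ≤ k) →
      (p = 0 ∨ q = 0 ∨ p.natAbs = 2 * k ∨ q.natAbs = 2 * k) →
      (x - p).natAbs + (y - q).natAbs = 1 →
      p.natAbs + q.natAbs < x.natAbs + y.natAbs →
      ∃ v' : CornerVertex k, v'.1.2.2 = 1 ∧ (cornerGraph k).Adj ⟨(x, y, 1), m0, m1, m2, m3, m4⟩ v' ∧
        v'.1.1.natAbs + v'.1.2.1.natAbs < x.natAbs + y.natAbs :=
    fun p q e1 e2 e3 e4 e5 h1 h2 => ⟨⟨(p, q, 1), isCornerPoint_top e1 e2 e3 e4 e5⟩, rfl,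
      by simpa [cornerGraph] using h1, h2⟩
  by_cases hx : x ≠ 0 ∧ (y = 0 ∨ y.natAbs = 2 * k)
  · rcases lt_or_gt_of_ne hx.1 with h | h
    · exact hstep (x + 1) y (by omega) (by omega) (by omega) (by omega) (by omega) (by omega)
        (by omega)
    · exact hstep (x - 1) y (by omega) (by omega) (by omega) (by omega) (by omega) (by omega)
        (by omega)
  · rcases lt_trichotomy y 0 with h | h | h
    · exact hstep x (y + 1) (by omega) (by omega) (by omega) (by omega) (by omega) (by omega)
        (by omega)
    · omega
    · exact hstep x (y - 1) (by omega) (by omega) (by omega) (by omega) (by omega) (by omega)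
        (by omega)

theorem CornerVertex.side {k : ℕ} (a : CornerVertex k) :
    ∃ ε : ℤ, (ε = 1 ∨ ε = -1) ∧ 0 ≤ ε * a.1.1 ∧ 0 ≤ ε * a.1.2.1 := by
  rcases a.2.1 with h | h
  · exact ⟨1, Or.inl rfl, by omega, by omega⟩
  · exact ⟨-1, Or.inr rfl, by omega, by omega⟩

theorem exists_walk_root {k : ℕ} (hk : 1 ≤ k) (a : CornerVertex k) :
    ∃ p : (cornerGraph k).Walk a (cornerRoot k),
      p.length ≤ a.1.1.natAbs + a.1.2.1.natAbs + 3 := by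
  by_cases ha : a.1.2.2 = 1
  · obtain ⟨p, hp⟩ := exists_walk_top_root a ha
    exact ⟨p, by omega⟩
  · have ha0 : a.1.2.2 = 0 := by
      have := a.2.2.2.2.2
      tauto
    obtain ⟨ε, hε, hx, hy⟩ := a.side
    -- No vertex lies beneath the root, so the ascent uses the neighbouring column. This costs up to
    -- three extra steps, the worst case being a start with first coordinate zero.
    let b : CornerVertex k := ⟨(ε, 0, 0), by
      rcases hε with rfl | rfl <;> apply isCornerPoint_bottom <;> omega⟩
    let c : CornerVertex k := ⟨(ε, 0, 1), by
      rcases hε with rfl | rfl <;> apply isCornerPoint_top <;> omega⟩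
    have hbc : (cornerGraph k).Adj b c := by simp [cornerGraph, b, c]
    have hcr : (cornerGraph k).Adj c (cornerRoot k) := by
      rcases hε with rfl | rfl <;> simp [cornerGraph, c, cornerRoot]
    obtain ⟨p, hp⟩ := exists_walk_bottom hk hε a b ⟨ha0, hx, hy⟩
      ⟨rfl, by simp only [b]; rcases hε with rfl | rfl <;> omega, by simp [b]⟩
    refine ⟨p.append (Walk.cons hbc (Walk.cons hcr Walk.nil)), ?_⟩
    simp only [Walk.length_append, Walk.length_cons, Walk.length_nil]
    simp only [b] at hp
    rcases hε with rfl | rfl <;> omega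

theorem cornerGraph_connected {k : ℕ} (hk : 1 ≤ k) : (cornerGraph k).Connected :=
  have : Nonempty (CornerVertex k) := ⟨cornerRoot k⟩
  have hr (a) : (cornerGraph k).Reachable a (cornerRoot k) := ⟨(exists_walk_root hk a).choose⟩
  ⟨fun a b => (hr a).trans (hr b).symm⟩

theorem le_cornerGraph_dist {k : ℕ} (hk : 1 ≤ k) (a b : CornerVertex k) :
    (a.1.1 - b.1.1).natAbs + (a.1.2.1 - b.1.2.1).natAbs + (a.1.2.2 - b.1.2.2).natAbs ≤
      (cornerGraph k).dist a b := by
  have h := le_add_dist (cornerGraph_connected hk)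
    (fun v => (((a.1.1 - v.1.1).natAbs + (a.1.2.1 - v.1.2.1).natAbs +
      (a.1.2.2 - v.1.2.2).natAbs : ℕ) : ℤ)) ?_ a b
  · simp only [sub_self, Int.natAbs_zero] at h
    omega
  · intro u v (huv : _ = 1)
    omega

/-- In one L-shape and away from the root, the distance is at most the planar one plus two. -/
theorem cornerGraph_dist_le_of_side {k : ℕ} (hk : 1 ≤ k) {ε : ℤ} (hε : ε = 1 ∨ ε = -1)
    (a b : CornerVertex k) (ha : 0 ≤ ε * a.1.1 ∧ 0 ≤ ε * a.1.2.1)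
    (hb : 0 ≤ ε * b.1.1 ∧ 0 ≤ ε * b.1.2.1) (ha' : a ≠ cornerRoot k) (hb' : b ≠ cornerRoot k) :
    (cornerGraph k).dist a b ≤ (a.1.1 - b.1.1).natAbs + (a.1.2.1 - b.1.2.1).natAbs + 2 := by
  have hdrop : ∀ v : CornerVertex k, v ≠ cornerRoot k → ∃ u : CornerVertex k,
      u.1.1 = v.1.1 ∧ u.1.2.1 = v.1.2.1 ∧ u.1.2.2 = 0 ∧ (cornerGraph k).dist v u ≤ 1 := by
    intro v hv
    rcases v.2.2.2.2.2 with ⟨ht, -⟩ | ⟨ht, -⟩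
    · exact ⟨v, rfl, rfl, ht, by simp⟩
    · have h0 : v.1.1 ≠ 0 ∨ v.1.2.1 ≠ 0 := by
        by_contra! h
        exact hv (Subtype.ext (Prod.ext h.1 (Prod.ext h.2 ht)))
      refine ⟨⟨(v.1.1, v.1.2.1, 0), isCornerPoint_bottom v.2.1 v.2.2.1 v.2.2.2.1 v.2.2.2.2.1 h0⟩,
        rfl, rfl, rfl, ?_⟩
      exact (dist_eq_one_iff_adj.2 (by simp [cornerGraph, ht])).le
  obtain ⟨a', ha1, ha2, ha3, ha4⟩ := hdrop a ha'
  obtain ⟨b', hb1, hb2, hb3, hb4⟩ := hdrop b hb'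
  obtain ⟨p, hp⟩ := exists_walk_bottom hk hε a' b' ⟨ha3, by rwa [ha1, ha2]⟩
    ⟨hb3, by rwa [hb1, hb2]⟩
  rw [ha1, ha2, hb1, hb2] at hp
  have h1 := dist_le p
  have h2 := (cornerGraph_connected hk).dist_triangle (u := a) (v := a') (w := b)
  have h3 := (cornerGraph_connected hk).dist_triangle (u := a') (v := b') (w := b)
  rw [SimpleGraph.dist_comm] at hb4
  omega

theorem cornerGraph_dist_root_le {k : ℕ} (hk : 1 ≤ k) (a : CornerVertex k) :
    (cornerGraph k).dist a (cornerRoot k) ≤ a.1.1.natAbs + a.1.2.1.natAbs + 3 := by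
  obtain ⟨p, hp⟩ := exists_walk_root hk a
  exact (dist_le p).trans hp

/-- Between opposite quadrants absolute coordinates add up, so a detour through the root loses only
three steps at each end. -/
theorem cornerGraph_dist_le {k : ℕ} (hk : 1 ≤ k) (a b : CornerVertex k) :
    (cornerGraph k).dist a b ≤ (a.1.1 - b.1.1).natAbs + (a.1.2.1 - b.1.2.1).natAbs + 6 := by
  have ha := cornerGraph_dist_root_le hk a
  have hb := cornerGraph_dist_root_le hk b
  have htri := (cornerGraph_connected hk).dist_triangle (u := a) (v := cornerRoot k) (w := b)
  rw [SimpleGraph.dist_comm] at hb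
  by_cases ha' : a = cornerRoot k
  · subst ha'
    simp only [cornerRoot] at hb ⊢
    omega
  by_cases hb' : b = cornerRoot k
  · subst hb'
    simp only [cornerRoot] at ha ⊢
    omega
  obtain ⟨ε, hε, hεa⟩ := a.side
  by_cases hεb : 0 ≤ ε * b.1.1 ∧ 0 ≤ ε * b.1.2.1
  · have := cornerGraph_dist_le_of_side hk hε a b hεa hεb ha' hb'
    omega
  · have := b.2.1
    rcases hε with rfl | rfl <;> omega

/-! ### Hyperbolicity of the L-shapes -/

theorem cornerGraph_hyperbolicity_le {k : ℕ} (hk : 1 ≤ k) :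
    hyperbolicity (cornerGraph k) ≤ k + 6 := by
  have h := hyperbolicity_le_of_planar (G := cornerGraph k) (fun v => v.1.1) (fun v => v.1.2.1)
    k 6 (fun u v => (Nat.le_add_right _ _).trans (le_cornerGraph_dist hk u v))
    (cornerGraph_dist_le hk) ?_
  · exact_mod_cast h
  · rintro ⟨p, hp⟩ ⟨q, hq⟩ ⟨r, hr⟩ ⟨s, hs⟩ ⟨x1, x2, x3, x4⟩ ⟨y1, y2, y3, y4⟩
    dsimp only at *
    obtain ⟨p0, -, -, p3, -⟩ := hp
    obtain ⟨s0, -, -, s3, -⟩ := hs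
    have q0 := hq.1
    have r0 := hr.1
    clear hq hr
    -- The off-diagonal corners `q`, `r` cannot lie in opposite quadrants. If both are nonnegative,
    -- `s` exceeds `k` in both coordinates; if both are nonpositive, `p` lies below `-k` in both.
    rcases q0 with q0 | q0 <;> rcases r0 with r0 | r0 <;> omega

/-- A square of side `k` at the root has ℓ¹ defect `k`; the error of six in each of two distances
lowers this by at most six. -/
theorem le_cornerGraph_hyperbolicity {k : ℕ} (hk : 1 ≤ k) :
    (k : ℝ) - 6 ≤ hyperbolicity (cornerGraph k) := by
  obtain ⟨x, hx1, hx2⟩ : ∃ x : CornerVertex k, x.1.1 = k ∧ x.1.2.1 = 0 :=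
    ⟨⟨(k, 0, 0), by apply isCornerPoint_bottom <;> omega⟩, rfl, rfl⟩
  obtain ⟨y, hy1, hy2⟩ : ∃ y : CornerVertex k, y.1.1 = 0 ∧ y.1.2.1 = k :=
    ⟨⟨(0, k, 0), by apply isCornerPoint_bottom <;> omega⟩, rfl, rfl⟩
  obtain ⟨z, hz1, hz2⟩ : ∃ z : CornerVertex k, z.1.1 = k ∧ z.1.2.1 = k :=
    ⟨⟨(k, k, 0), by apply isCornerPoint_bottom <;> omega⟩, rfl, rfl⟩
  have hr1 : (cornerRoot k).1.1 = 0 := rfl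
  have hr2 : (cornerRoot k).1.2.1 = 0 := rfl
  have h := fourPoint_le_hyperbolicity (G := cornerGraph k) (cornerRoot k) x y z
  have h1 : 2 * k ≤ (cornerGraph k).dist x y := by
    have := le_cornerGraph_dist hk x y
    omega
  have h2 : 2 * k ≤ (cornerGraph k).dist z (cornerRoot k) := by
    have := le_cornerGraph_dist hk z (cornerRoot k)
    omega
  have h3 : (cornerGraph k).dist x z ≤ k + 6 := by
    have := cornerGraph_dist_le hk x z
    omega
  have h4 : (cornerGraph k).dist y (cornerRoot k) ≤ k + 6 := by
    have := cornerGraph_dist_le hk y (cornerRoot k)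
    omega
  have h5 : (cornerGraph k).dist y z ≤ k + 6 := by
    have := cornerGraph_dist_le hk y z
    omega
  have h6 : (cornerGraph k).dist x (cornerRoot k) ≤ k + 6 := by
    have := cornerGraph_dist_le hk x (cornerRoot k)
    omega
  rify at h1 h2 h3 h4 h5 h6
  rcases le_max_iff.1 (sub_le_iff_le_add.2 h) with h | h <;> linarith

/-! ### Forced boundary routes and large minsize -/

/-- Every route from one L-shape to the other passes through the root. -/
theorem le_dist_across {k : ℕ} (hk : 1 ≤ k) {ε : ℤ} (hε : ε = 1 ∨ ε = -1)
    (v u : CornerVertex k) (hv : 0 ≤ ε * v.1.1 ∧ 0 ≤ ε * v.1.2.1)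
    (hu : ¬(0 ≤ ε * u.1.1 ∧ 0 ≤ ε * u.1.2.1)) :
    (cornerGraph k).dist v (cornerRoot k) +
      (u.1.1.natAbs + u.1.2.1.natAbs + (1 - u.1.2.2).natAbs) ≤ (cornerGraph k).dist v u := by
  classical
  have hc := cornerGraph_connected hk
  have h := le_add_dist hc (fun u => if 0 ≤ ε * u.1.1 ∧ 0 ≤ ε * u.1.2.1 then
    ((cornerGraph k).dist v u : ℤ) else (((cornerGraph k).dist v (cornerRoot k) +
      (u.1.1.natAbs + u.1.2.1.natAbs + (1 - u.1.2.2).natAbs) : ℕ) : ℤ)) ?_ v u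
  · simp only [if_pos hv, if_neg hu, SimpleGraph.dist_self] at h
    omega
  · intro a b hab
    have hab' : (a.1.1 - b.1.1).natAbs + (a.1.2.1 - b.1.2.1).natAbs +
      (a.1.2.2 - b.1.2.2).natAbs = 1 := hab
    have hroot : ∀ c : CornerVertex k, c.1.1 = 0 → c.1.2.1 = 0 → c = cornerRoot k := by
      intro c hx hy
      have ht : c.1.2.2 = 1 := by
        have := c.2.2.2.2.2
        omega
      exact Subtype.ext (Prod.ext hx (Prod.ext hy ht))
    have ha := a.2.1
    have hb := b.2.1
    split_ifs with h1 h2 h2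
    · have h3 := hc.dist_triangle (u := v) (v := a) (w := b)
      rw [dist_eq_one_iff_adj.2 hab] at h3
      exact_mod_cast h3
    -- The two sides meet only in the root, where the second formula reduces to the first.
    · have : b = cornerRoot k :=
        hroot b (by rcases hε with rfl | rfl <;> omega) (by rcases hε with rfl | rfl <;> omega)
      subst this
      clear * -
      omega
    · have : a = cornerRoot k :=
        hroot a (by rcases hε with rfl | rfl <;> omega) (by rcases hε with rfl | rfl <;> omega)
      subst this
      have hr1 : (cornerRoot k).1.1 = 0 := rfl
      have hr2 : (cornerRoot k).1.2.1 = 0 := rfl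
      have hr3 : (cornerRoot k).1.2.2 = 1 := rfl
      clear * - hab' hr1 hr2 hr3
      omega
    · clear * - hab'
      omega

/-- Adding `hfar` and `hnear` leaves no room for a vertical step, so the point is on the top layer
and on a monotone route to the end of the arm. For `k ≥ 2` one has `s > k`, which rules out the
other axis. -/
theorem boundary_point_eq {k s : ℕ} (hk : 2 ≤ k) (hs : 2 * k ≤ s + 1) (hs' : s ≤ 2 * k) {ε : ℤ}
    (hε : ε = 1 ∨ ε = -1) {p q t : ℤ}
    (hfar : (p - -ε * (2 * k)).natAbs + (q - -ε * k).natAbs + (t - 1).natAbs + s ≤ 3 * k)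
    (hnear : p.natAbs + q.natAbs + (1 - t).natAbs ≤ s)
    (ht : (t = 0 ∧ (p ≠ 0 ∨ q ≠ 0)) ∨
      (t = 1 ∧ (p = 0 ∨ q = 0 ∨ p.natAbs = 2 * k ∨ q.natAbs = 2 * k))) :
    p = -ε * s ∧ q = 0 := by
  have h1 : t = 1 := by rcases hε with rfl | rfl <;> omega
  subst h1
  rcases hε with rfl | rfl <;> omega

theorem le_rootedInsize_cornerGraph {k : ℕ} (hk : 2 ≤ k) (v : CornerVertex k)
    (T : SimpleGraph (CornerVertex k)) (hT : IsBFSTree (cornerGraph k) v T) :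
    ((4 * k - 2 : ℕ) : ℕ∞) ≤ rootedInsize (cornerGraph k) v T := by
  have hk1 : 1 ≤ k := by omega
  have hc := cornerGraph_connected hk1
  obtain ⟨ε, hε, hv⟩ := v.side
  obtain ⟨x, hx1, hx2, hx3⟩ : ∃ x : CornerVertex k,
      x.1.1 = -ε * (2 * k) ∧ x.1.2.1 = -ε * k ∧ x.1.2.2 = 1 :=
    ⟨⟨(-ε * (2 * k), -ε * k, 1), by
      rcases hε with rfl | rfl <;> apply isCornerPoint_top <;> omega⟩, rfl, rfl, rfl⟩
  obtain ⟨y, hy1, hy2, hy3⟩ : ∃ y : CornerVertex k,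
      y.1.1 = -ε * k ∧ y.1.2.1 = -ε * (2 * k) ∧ y.1.2.2 = 1 :=
    ⟨⟨(-ε * k, -ε * (2 * k), 1), by
      rcases hε with rfl | rfl <;> apply isCornerPoint_top <;> omega⟩, rfl, rfl, rfl⟩
  have htarget : ∀ z : CornerVertex k, z.1.2.2 = 1 → ¬(0 ≤ ε * z.1.1 ∧ 0 ≤ ε * z.1.2.1) →
      z.1.1.natAbs + z.1.2.1.natAbs = 3 * k →
      (cornerGraph k).dist v z = (cornerGraph k).dist v (cornerRoot k) + 3 * k := by
    intro z hz1 hz2 hz3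
    have h1 := le_dist_across hk1 hε v z hv hz2
    obtain ⟨p, hp⟩ := exists_walk_top_root z hz1
    have h2 := dist_le p
    rw [SimpleGraph.dist_comm] at h2
    have h3 := hc.dist_triangle (u := v) (v := cornerRoot k) (w := z)
    omega
  have hxs : ¬(0 ≤ ε * x.1.1 ∧ 0 ≤ ε * x.1.2.1) := by
    rw [hx1, hx2]; rcases hε with rfl | rfl <;> omega
  have hys : ¬(0 ≤ ε * y.1.1 ∧ 0 ≤ ε * y.1.2.1) := by
    rw [hy1, hy2]; rcases hε with rfl | rfl <;> omega
  have hx := htarget x hx3 hxs (by rw [hx1, hx2]; rcases hε with rfl | rfl <;> omega)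
  have hy := htarget y hy3 hys (by rw [hy1, hy2]; rcases hε with rfl | rfl <;> omega)
  have hlow : 2 * k ≤ (cornerGraph k).dist x y := by
    refine le_trans ?_ (le_cornerGraph_dist hk1 x y)
    rw [hx1, hx2, hy1, hy2]; rcases hε with rfl | rfl <;> omega
  have hupp : (cornerGraph k).dist x y ≤ 2 * k + 2 := by
    refine (cornerGraph_dist_le_of_side hk1 (ε := -ε) (by omega) x y ?_ ?_ ?_ ?_).trans ?_
    · rw [hx1, hx2]; rcases hε with rfl | rfl <;> omega
    · rw [hy1, hy2]; rcases hε with rfl | rfl <;> omega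
    · intro h
      rw [h] at hxs
      simp [cornerRoot] at hxs
    · intro h
      rw [h] at hys
      simp [cornerRoot] at hys
    · rw [hx1, hx2, hy1, hy2]; rcases hε with rfl | rfl <;> omega
  -- Half of `d(x, y)` is between `k` and `k + 1`, so beyond the root the height `s` is `2 * k - 1`
  -- or `2 * k`. The cut points are then `2 * s ≥ 4 * k - 2` apart.
  obtain ⟨s, hs, hs1, hs2⟩ : ∃ s : ℕ, ⌊gromovProduct (cornerGraph k) v x y⌋₊ =
      (cornerGraph k).dist v (cornerRoot k) + s ∧ 2 * k ≤ s + 1 ∧ s ≤ 2 * k := by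
    have hg : gromovProduct (cornerGraph k) v x y =
        (cornerGraph k).dist v (cornerRoot k) + 3 * k - (cornerGraph k).dist x y / 2 := by
      unfold gromovProduct
      rw [SimpleGraph.dist_comm (u := x) (v := v), SimpleGraph.dist_comm (u := y) (v := v),
        hx, hy]
      push_cast
      ring
    have hlow' : (2 * k : ℝ) ≤ (cornerGraph k).dist x y := by exact_mod_cast hlow
    have hupp' : ((cornerGraph k).dist x y : ℝ) ≤ 2 * k + 2 := by exact_mod_cast hupp
    have h1 : (cornerGraph k).dist v (cornerRoot k) + (2 * k - 1) ≤
        ⌊gromovProduct (cornerGraph k) v x y⌋₊ := by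
      refine Nat.le_floor ?_
      rw [hg, Nat.cast_add, Nat.cast_sub (by omega)]
      push_cast
      linarith
    have h2 : ⌊gromovProduct (cornerGraph k) v x y⌋₊ ≤
        (cornerGraph k).dist v (cornerRoot k) + 2 * k := by
      refine Nat.floor_le_of_le ?_
      rw [hg]
      push_cast
      linarith
    exact ⟨⌊gromovProduct (cornerGraph k) v x y⌋₊ - (cornerGraph k).dist v (cornerRoot k),
      by omega, by omega, by omega⟩
  obtain ⟨a, hTa, ha1, ha2⟩ := hT.exists_isTreePathVertexAt (x := x)
    (r := (cornerGraph k).dist v (cornerRoot k) + s) (by omega)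
  obtain ⟨b, hTb, hb1, hb2⟩ := hT.exists_isTreePathVertexAt (x := y)
    (r := (cornerGraph k).dist v (cornerRoot k) + s) (by omega)
  have hbound := le_rootedInsize hs hTa hTb
  have ha3 := le_cornerGraph_dist hk1 a x
  have hb3 := le_cornerGraph_dist hk1 b y
  rw [hx1, hx2, hx3] at ha3
  rw [hy1, hy2, hy3] at hb3
  have ha5 : (cornerGraph k).dist a x + s ≤ 3 * k := by omega
  have hb5 : (cornerGraph k).dist b y + s ≤ 3 * k := by omega
  -- The point `a` is within `k + 1 < 2 * k` of `x`, hence still on the far side of the root;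
  -- likewise `b` and `y`.
  have ha4 := le_dist_across hk1 hε v a hv (by
    clear * - ha3 ha5 hs1 hk hε; rcases hε with rfl | rfl <;> omega)
  have hb4 := le_dist_across hk1 hε v b hv (by
    clear * - hb3 hb5 hs1 hk hε; rcases hε with rfl | rfl <;> omega)
  have hac : a.1.1 = -ε * s ∧ a.1.2.1 = 0 :=
    boundary_point_eq hk hs1 hs2 hε (by linarith) (by linarith) a.2.2.2.2.2
  have hbc : b.1.2.1 = -ε * s ∧ b.1.1 = 0 :=
    boundary_point_eq hk hs1 hs2 hε (t := b.1.2.2) (by linarith) (by linarith) (by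
      have := b.2.2.2.2.2
      clear * - this
      tauto)
  have hab := le_cornerGraph_dist hk1 a b
  rw [hac.1, hac.2, hbc.2, hbc.1] at hab
  refine le_trans ?_ hbound
  have hfin : 4 * k - 2 ≤ (cornerGraph k).dist a b := by
    clear * - hab hε hs1
    rcases hε with rfl | rfl <;> omega
  exact_mod_cast hfin

/-! ### The three assertions -/

theorem exists_large_minsize : ∃ C : ℝ, ∀ k : ℕ, 1 ≤ k →
    ∃ (V : Type) (_ : Finite V) (H : SimpleGraph V), H.Connected ∧
      |hyperbolicity H - (k : ℝ)| ≤ C ∧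
      (∀ (w : V) (T : SimpleGraph V), IsBFSTree H w T →
        ((4 * k - 2 : ℕ) : ℕ∞) ≤ rootedInsize H w T) ∧
      ((4 * k - 2 : ℕ) : ℕ∞) ≤ minsize H ∧ minsize H ≤ maxsize H := by
  -- The graph used is `cornerGraph (k + 1)`, so that its parameter is at least two; the shift adds
  -- one to the error six.
  refine ⟨7, fun k _ => ?_⟩
  have hk' : 1 ≤ k + 1 := by omega
  have hc := cornerGraph_connected hk'
  have hrooted : ∀ (w : CornerVertex (k + 1)) (T : SimpleGraph (CornerVertex (k + 1))),
      IsBFSTree (cornerGraph (k + 1)) w T →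
      ((4 * k - 2 : ℕ) : ℕ∞) ≤ rootedInsize (cornerGraph (k + 1)) w T := fun w T hT =>
    (Nat.cast_le.2 (by omega)).trans (le_rootedInsize_cornerGraph (by omega) w T hT)
  refine ⟨_, inferInstance, cornerGraph (k + 1), hc, ?_, hrooted, le_sInf ?_,
    minsize_le_maxsize hc⟩
  · have h1 := cornerGraph_hyperbolicity_le hk'
    have h2 := le_cornerGraph_hyperbolicity hk'
    push_cast at h1 h2
    rw [abs_le]
    constructor <;> linarith
  · rintro _ ⟨w, T, hT, rfl⟩
    exact hrooted w T hT

theorem exists_small_minsize : ∀ k : ℕ, 1 ≤ k →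
    ∃ (V : Type) (_ : Finite V) (G : SimpleGraph V), G.Connected ∧
      hyperbolicity G = 4 * (k : ℝ) ∧ minsize G ≤ ((2 * k : ℕ) : ℕ∞) := by
  refine fun k _ => ⟨_, inferInstance, boxGrid (2 * k), boxGrid_connected _, ?_,
    boxGrid_minsize_le (even_two_mul k)⟩
  rw [boxGrid_hyperbolicity]
  push_cast
  ring

theorem eight_le_of_approximation (f : ℕ → ℝ) (a b : ℝ) (hf : Monotone f)
    (h : ∀ (V : Type) (_ : Finite V) (G : SimpleGraph V), G.Connected →
      ∀ r : ℕ, minsize G = (r : ℕ∞) →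
        hyperbolicity G ≤ f r ∧ f r ≤ a * hyperbolicity G + b) : 8 ≤ a := by
  obtain ⟨C, hC⟩ := exists_large_minsize
  have key : ∀ k : ℕ, 1 ≤ k → (8 - a) * k ≤ |a| * C + b + 4 := by
    intro k hk
    -- The parameter `2 * k - 1` makes the upper bound `4 * k - 2` on the minsize of `G` match the
    -- lower bound for `H`, so monotonicity of `f` applies.
    obtain ⟨V, _, G, hG, hδ, hmin⟩ := exists_small_minsize (2 * k - 1) (by omega)
    obtain ⟨W, _, H, hH, hδ', -, hmin', -⟩ := hC k hk
    obtain ⟨r, hr⟩ := ENat.ne_top_iff_exists.1 (minsize_ne_top hG)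
    obtain ⟨r', hr'⟩ := ENat.ne_top_iff_exists.1 (minsize_ne_top hH)
    rw [← hr, Nat.cast_le] at hmin
    rw [← hr', Nat.cast_le] at hmin'
    have h1 := (h V inferInstance G hG r hr.symm).1
    have h2 := (h W inferInstance H hH r' hr'.symm).2
    have h3 : f r ≤ f r' := hf (by omega)
    have h4 : a * (hyperbolicity H - k) ≤ |a| * C :=
      (le_abs_self _).trans (by
        rw [abs_mul]
        exact mul_le_mul_of_nonneg_left hδ' (abs_nonneg a))
    rw [hδ, Nat.cast_sub (by omega)] at h1
    push_cast at h1
    linarith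
  by_contra! ha
  obtain ⟨n, hn⟩ := exists_nat_gt ((|a| * C + b + 4) / (8 - a))
  have h1 := key (n + 1) (by omega)
  rw [div_lt_iff₀ (by linarith)] at hn
  push_cast at h1
  linarith

end RootedInsize

theorem mainTheorem11 :
    (∃ C : ℝ, ∀ k : ℕ, 1 ≤ k →
      ∃ (V : Type) (_ : Finite V) (H : SimpleGraph V), H.Connected ∧
        |RootedInsize.hyperbolicity H - (k : ℝ)| ≤ C ∧
        (∀ (w : V) (T : SimpleGraph V), RootedInsize.IsBFSTree H w T →
          ((4 * k - 2 : ℕ) : ℕ∞) ≤ RootedInsize.rootedInsize H w T) ∧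
        ((4 * k - 2 : ℕ) : ℕ∞) ≤ RootedInsize.minsize H ∧
        RootedInsize.minsize H ≤ RootedInsize.maxsize H) ∧
    (∀ k : ℕ, 1 ≤ k →
      ∃ (V : Type) (_ : Finite V) (G : SimpleGraph V), G.Connected ∧
        RootedInsize.hyperbolicity G = 4 * (k : ℝ) ∧
        RootedInsize.minsize G ≤ ((2 * k : ℕ) : ℕ∞)) ∧
    (∀ (f : ℕ → ℝ) (a b : ℝ), Monotone f →
      (∀ (V : Type) (_ : Finite V) (G : SimpleGraph V), G.Connected →
        ∀ r : ℕ, RootedInsize.minsize G = (r : ℕ∞) →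
          RootedInsize.hyperbolicity G ≤ f r ∧
            f r ≤ a * RootedInsize.hyperbolicity G + b) →
      8 ≤ a) :=
  ⟨RootedInsize.exists_large_minsize, RootedInsize.exists_small_minsize,
    RootedInsize.eight_le_of_approximation⟩
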